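/- Proposition. A quasi-metric on a set $X$ is a function $d\colon X\times X\to[0,\infty)$ with $d(x,z)\le d(x,y)+d(y,z)$ for all $x,y,z$, and $x=y$ if and only if $d(x,y)=d(y,x)=0$. It induces the topology generated by the balls $\{y \mid d(x,y)<\varepsilon\}$, and it is Smyth-complete if every sequence $(x_n)_n$ such that for each $\varepsilon>0$ there is $N$ with $d(x_n,x_m)<\varepsilon$ whenever $N\le n\le m$ converges with respect to the metric $\max\{d(x,y),d(y,x)\}$. A topological space is quasi-Polish if it is countably based (has a countable basis) and its topology is induced by a Smyth-complete quasi-metric. A space is locally compact if every neighbourhood of every point contains a compact neighbourhood of that point. For a topological space $X$, let $\mathbf{O}(X)$ denote the lattice of open subsets of $X$, ordered by inclusion and equipped with the Scott topology. Let $X$ be a quasi-Polish space. Then the following are equivalent: 1. $X$ is locally compact; 2. $\mathbf{O}(X)$ is quasi-Polish; 3. $\mathbf{O}(X)$ is countably based; 4. $\mathbf{O}(X)$ is locally compact; 5. $\mathbf{O}(\mathbf{O}(X))$ is locally compact. -/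

import Mathlib

open Filter Topology

universe u

/-- A quasi-metric on `X`: a nonnegative real-valued function satisfying the triangle inequality
and vanishing in both directions exactly on the diagonal (symmetry is not required). -/
structure QuasiMetric (X : Type u) where
  /-- The distance from one point to another. -/
  qdist : X → X → ℝ
  nonneg : ∀ x y, 0 ≤ qdist x y
  eq_iff : ∀ x y, x = y ↔ qdist x y = 0 ∧ qdist y x = 0
  triangle : ∀ x y z, qdist x z ≤ qdist x y + qdist y z

namespace QuasiMetric

variable {X : Type u} (d : QuasiMetric X)

/-- The open ball `{y | d(x, y) < ε}`. -/
def ball (x : X) (ε : ℝ) : Set X := {y | d.qdist x y < ε}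

/-- The topology induced by a quasi-metric: a set is open when it contains an open ball around
each of its points. -/
@[reducible]
def topology : TopologicalSpace X where
  IsOpen s := ∀ x ∈ s, ∃ ε : ℝ, 0 < ε ∧ d.ball x ε ⊆ s
  isOpen_univ := fun _ _ => ⟨1, one_pos, Set.subset_univ _⟩
  isOpen_inter := fun s t hs ht x hx => by
    obtain ⟨ε, hε, hεs⟩ := hs x hx.1
    obtain ⟨δ, hδ, hδt⟩ := ht x hx.2
    exact ⟨min ε δ, lt_min hε hδ, fun y hy =>
      ⟨hεs (lt_of_lt_of_le hy (min_le_left ε δ)), hδt (lt_of_lt_of_le hy (min_le_right ε δ))⟩⟩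
  isOpen_sUnion := fun S hS x hx => by
    obtain ⟨s, hsS, hxs⟩ := hx
    obtain ⟨ε, hε, hεs⟩ := hS s hsS x hxs
    exact ⟨ε, hε, hεs.trans (Set.subset_sUnion_of_mem hsS)⟩

/-- A (forward) Cauchy sequence: for every `ε > 0`, eventually `d(uₙ, uₘ) < ε` for `n ≤ m`. -/
def IsCauchy (w : ℕ → X) : Prop :=
  ∀ ε : ℝ, 0 < ε → ∃ N : ℕ, ∀ n m : ℕ, N ≤ n → n ≤ m → d.qdist (w n) (w m) < ε

/-- Smyth-completeness: every Cauchy sequence converges with respect to the symmetrized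
metric `max (d(x, y)) (d(y, x))`. -/
def SmythComplete : Prop :=
  ∀ w : ℕ → X, d.IsCauchy w →
    ∃ x : X, Tendsto (fun n => max (d.qdist x (w n)) (d.qdist (w n) x)) atTop (𝓝 0)

end QuasiMetric

/-- A space is quasi-Polish if it is countably based and its topology is induced by a
Smyth-complete quasi-metric. -/
def QuasiPolish (X : Type u) [t : TopologicalSpace X] : Prop :=
  SecondCountableTopology X ∧ ∃ d : QuasiMetric X, d.SmythComplete ∧ t = d.topology

/-- The lattice of open subsets of `X`, ordered by inclusion, with the Scott topology. -/
abbrev OpenLattice (X : Type u) [TopologicalSpace X] : Type u :=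
  Topology.WithScott (TopologicalSpace.Opens X)

/-!
For a countably based `X`, let `O(X)` carry the Scott topology.

*Locally compact spaces.* If `X` is locally compact, an open set is the directed union of the open
sets lying inside its compact subsets (`CompactlyBelow`). Hence principal filters form compact
neighbourhoods in `O(X)` (`OpenLattice.locallyCompactSpace`), and the families of open sets that
have a given basic open set compactly below them form a countable basis
(`OpenLattice.secondCountableTopology`). For a Smyth-complete quasi-metric on `O(X)`, assign to `U`
and each basic `B i` the least `j` such that `B i` is compactly below `B j` and `B j` compactly
below `U`. Distances record the first `i` at which this rank increases. Along a Cauchy sequence all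
ranks stabilize, and since stable ranks name fixed interpolants `B j`, they are the ranks of an
open set (`OpenLattice.quasiPolish`).

*Consonance.* In a quasi-Polish space, an open set `U` in a Scott-open family contains a decreasing
sequence of members of the family, each a finite union of small balls, such that every ultrafilter
containing the sequence converges to a point of its intersection: Kőnig's lemma extracts a Cauchy
sequence of centres (`QuasiMetric.SmythComplete.exists_isCompactoidSeq`). The intersection is a
compact set all of whose open neighbourhoods belong to the family (`QuasiPolish.exists_isCompact`).
If moreover `O(X)` is first countable, comparing countable neighbourhood bases of a point `x` and of
an open `U` containing it gives a neighbourhood of `x` contained in all open sets close to `U`, and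
consonance turns it into a compact one inside `U` (`QuasiPolish.locallyCompactSpace`).

*The double lattice.* A union of compact sets that enter every member of such a sequence stays
compact once the intersection of the sequence is added. This implies that the Scott topology on
`O(O(X))` is the topology of pointwise convergence on a countable basis of `X`, so `O(O(X))` is
countably based for every quasi-Polish `X` (`QuasiPolish.secondCountableTopology_double`). If
`O(O(X))` is also locally compact, then `O(O(O(X)))` is countably based, and so is its retract
`O(X)` (`OpenLattice.isEmbedding_nhdsFamily`).
-/

open TopologicalSpace (Opens)
open Topology.WithScott (toScott ofScott)

/-! ### Scott-open families of open sets -/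

namespace OpenLattice

variable {X : Type u} [TopologicalSpace X]

theorem isOpen_iff {s : Set (OpenLattice X)} :
    IsOpen s ↔ (∀ U V : Opens X, U ≤ V → toScott U ∈ s → toScott V ∈ s) ∧
      ∀ S : Set (Opens X), S.Nonempty → DirectedOn (· ≤ ·) S → toScott (sSup S) ∈ s →
        ∃ V ∈ S, toScott V ∈ s := by
  rw [Topology.IsScott.isOpen_iff_isUpperSet_and_dirSupInaccOn (D := Set.univ),
    dirSupInaccOn_univ]
  refine and_congr ⟨fun h U V hUV hU => h hUV hU, fun h U V hUV hU => h U V hUV hU⟩ ?_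
  constructor
  · intro h S hS hdir hsup
    obtain ⟨V, hV, hVs⟩ := @h S hS hdir (toScott (sSup S)) (isLUB_sSup S) hsup
    exact ⟨V, hV, hVs⟩
  · intro h S hS hdir a ha has
    obtain ⟨V, hV, hVs⟩ := h S hS hdir (by
      have : a = toScott (sSup (α := Opens X) S) :=
        IsLUB.unique (α := Opens X) ha (isLUB_sSup (α := Opens X) S)
      rwa [← this])
    exact ⟨V, hV, hVs⟩

theorem mem_of_le {s : Set (OpenLattice X)} (hs : IsOpen s) {U V : Opens X} (hUV : U ≤ V)
    (hU : toScott U ∈ s) : toScott V ∈ s :=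
  (isOpen_iff.1 hs).1 U V hUV hU

theorem exists_mem_of_le_iSup {s : Set (OpenLattice X)} (hs : IsOpen s) {ι : Type*} [Nonempty ι]
    {W : ι → Opens X} (hW : Directed (· ≤ ·) W) {U : Opens X} (hU : toScott U ∈ s)
    (hUW : U ≤ ⨆ i, W i) : ∃ i, toScott (W i) ∈ s := by
  obtain ⟨_, ⟨i, rfl⟩, hi⟩ := (isOpen_iff.1 hs).2 (Set.range W) (Set.range_nonempty W)
    hW.directedOn_range (mem_of_le hs hUW hU)
  exact ⟨i, hi⟩

theorem exists_finset_iSup_mem {s : Set (OpenLattice X)} (hs : IsOpen s) {ι : Type*}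
    {W : ι → Opens X} {U : Opens X} (hU : toScott U ∈ s) (hUW : U ≤ ⨆ i, W i) :
    ∃ t : Finset ι, toScott (⨆ i ∈ t, W i) ∈ s := by
  classical
  refine exists_mem_of_le_iSup hs (W := fun t : Finset ι => ⨆ i ∈ t, W i) ?_ hU ?_
  · refine Monotone.directed_le fun t t' htt' => ?_
    exact biSup_mono fun i hi => htt' hi
  · exact hUW.trans (iSup_eq_iSup_finset W).le

/-- The open sets containing a fixed compact set form a Scott-open family. -/
theorem isOpen_setOf_subset {K : Set X} (hK : IsCompact K) :
    IsOpen {U : OpenLattice X | K ⊆ (ofScott U : Opens X)} := by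
  refine isOpen_iff.2 ⟨fun U V hUV hU => Set.Subset.trans hU hUV, fun S hS hdir hsup => ?_⟩
  have := hS.to_subtype
  obtain ⟨V, hV⟩ := hK.elim_directed_cover (fun V : S => ((V : Opens X) : Set X))
    (fun V => V.1.isOpen)
    (by
      intro x hx
      have hx' : x ∈ sSup S := hsup hx
      obtain ⟨V, hV, hxV⟩ := Opens.mem_sSup.1 hx'
      exact Set.mem_iUnion.2 ⟨⟨V, hV⟩, hxV⟩)
    (by
      intro V W
      obtain ⟨Z, hZ, h1, h2⟩ := hdir V V.2 W W.2
      exact ⟨⟨Z, hZ⟩, h1, h2⟩)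
  exact ⟨V, V.2, hV⟩

/-- The open sets containing a fixed point form a Scott-open family. -/
theorem isOpen_setOf_mem (x : X) : IsOpen {U : OpenLattice X | x ∈ (ofScott U : Opens X)} := by
  simpa using isOpen_setOf_subset (isCompact_singleton (x := x))

/-- The preimage map on open sets is continuous for the Scott topologies. -/
theorem continuous_comap {Y : Type u} [TopologicalSpace Y] (f : C(X, Y)) :
    Continuous (fun U : OpenLattice Y => (toScott (Opens.comap f (ofScott U)) : OpenLattice X)) := by
  refine continuous_def.2 fun s hs => isOpen_iff.2 ⟨fun U V hUV hU => ?_, fun S hS hdir hsup => ?_⟩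
  · exact mem_of_le hs (Opens.comap_mono f hUV) hU
  · have := hS.to_subtype
    obtain ⟨i, hi⟩ := exists_mem_of_le_iSup hs (W := fun V : S => Opens.comap f V) (by
      intro V W
      obtain ⟨Z, hZ, h1, h2⟩ := hdir V V.2 W W.2
      exact ⟨⟨Z, hZ⟩, Opens.comap_mono f h1, Opens.comap_mono f h2⟩) hsup (by
      intro x hx
      obtain ⟨V, hV, hxV⟩ := Opens.mem_sSup.1 (show f x ∈ sSup S from hx)
      exact Opens.mem_iSup.2 ⟨⟨V, hV⟩, hxV⟩)
    exact ⟨i, i.2, hi⟩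

end OpenLattice

/-! ### Enumerated bases -/

/-- A countable basis, enumerated by `ℕ` and closed under finite unions. -/
structure IsUnionBasis {X : Type u} [TopologicalSpace X] (B : ℕ → Opens X) : Prop where
  exists_mem : ∀ (U : Opens X) (x : X), x ∈ U → ∃ n, x ∈ B n ∧ B n ≤ U
  exists_bot : ∃ n, B n = ⊥
  exists_sup : ∀ i j, ∃ k, B k = B i ⊔ B j

theorem exists_isUnionBasis (X : Type u) [TopologicalSpace X] [SecondCountableTopology X] :
    ∃ B : ℕ → Opens X, IsUnionBasis B := by
  classical
  obtain ⟨b, hb, -, hbasis⟩ := TopologicalSpace.exists_countable_basis X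
  have : Countable b := hb
  obtain ⟨e, he⟩ := exists_surjective_nat (Finset b)
  let C : Finset b → Opens X := fun F => F.sup fun s => ⟨s.1, hbasis.isOpen s.2⟩
  refine ⟨fun n => C (e n), fun U x hx => ?_, ?_, fun i j => ?_⟩
  · obtain ⟨s, hs, hxs, hsU⟩ := hbasis.exists_subset_of_mem_open hx U.isOpen
    obtain ⟨n, hn⟩ := he {⟨s, hs⟩}
    refine ⟨n, ?_, ?_⟩ <;> simp only [hn, C, Finset.sup_singleton]
    · exact hxs
    · exact hsU
  · obtain ⟨n, hn⟩ := he ∅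
    exact ⟨n, by simp [hn, C]⟩
  · obtain ⟨n, hn⟩ := he (e i ∪ e j)
    exact ⟨n, by simp only [hn, C, Finset.sup_union]⟩

namespace IsUnionBasis

variable {X : Type u} [TopologicalSpace X] {B : ℕ → Opens X}

theorem nonempty_below (hB : IsUnionBasis B) (U : Opens X) : Nonempty {n // B n ≤ U} := by
  obtain ⟨n, hn⟩ := hB.exists_bot
  exact ⟨⟨n, hn.trans_le bot_le⟩⟩

theorem directed_below (hB : IsUnionBasis B) (U : Opens X) :
    Directed (· ≤ ·) fun n : {n // B n ≤ U} => B n := by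
  intro i j
  obtain ⟨k, hk⟩ := hB.exists_sup i j
  exact ⟨⟨k, hk.trans_le (sup_le i.2 j.2)⟩, le_sup_left.trans hk.ge, le_sup_right.trans hk.ge⟩

theorem le_iSup_below (hB : IsUnionBasis B) (U : Opens X) :
    U ≤ ⨆ n : {n // B n ≤ U}, B n := by
  intro x hx
  obtain ⟨n, hxn, hn⟩ := hB.exists_mem U x hx
  exact Opens.mem_iSup.2 ⟨⟨n, hn⟩, hxn⟩

theorem exists_le_mem (hB : IsUnionBasis B) {s : Set (OpenLattice X)} (hs : IsOpen s)
    {U : Opens X} (hU : toScott U ∈ s) : ∃ n, B n ≤ U ∧ toScott (B n) ∈ s := by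
  have := hB.nonempty_below U
  obtain ⟨n, hn⟩ := OpenLattice.exists_mem_of_le_iSup hs (hB.directed_below U) hU
    (hB.le_iSup_below U)
  exact ⟨n, n.2, hn⟩

theorem exists_between (hB : IsUnionBasis B) {K : Set X} (hK : IsCompact K) {U : Opens X}
    (hKU : K ⊆ U) : ∃ n, K ⊆ B n ∧ B n ≤ U := by
  obtain ⟨n, h1, h2⟩ := hB.exists_le_mem (OpenLattice.isOpen_setOf_subset hK) (U := U) hKU
  exact ⟨n, h2, h1⟩

end IsUnionBasis

/-! ### Kőnig's lemma -/

theorem exists_mem_forall_of_antitone_finite {α : Type*} {A : Set α} (hA : A.Finite)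
    {S : ℕ → Set α} (hS : Antitone S) (hSA : ∀ k, S k ⊆ A) (hne : ∀ k, (S k).Nonempty) :
    ∃ a, ∀ k, a ∈ S k := by
  by_contra! h
  choose f hf using h
  obtain ⟨M, hM⟩ := (hA.image f).bddAbove
  obtain ⟨a, ha⟩ := hne M
  exact hf a (hS (hM ⟨a, hSA M ha, rfl⟩) ha)

/-- `HasChain A R k n a`: some `R`-chain of length `k` starts at `a ∈ A n` and climbs one level at
each step. -/
def HasChain {α : Type*} (A : ℕ → Set α) (R : α → α → Prop) : ℕ → ℕ → α → Prop
  | 0, n, a => a ∈ A n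
  | k + 1, n, a => a ∈ A n ∧ ∃ b, R a b ∧ HasChain A R k (n + 1) b

/-- Kőnig's lemma for a tree given by its finite nonempty levels, in which every node has a
parent. -/
theorem exists_branch {α : Type*} {A : ℕ → Set α} {R : α → α → Prop} (hfin : ∀ n, (A n).Finite)
    (hne : ∀ n, (A n).Nonempty) (hR : ∀ n, ∀ b ∈ A (n + 1), ∃ a ∈ A n, R a b) :
    ∃ a : ℕ → α, ∀ n, a n ∈ A n ∧ R (a n) (a (n + 1)) := by
  have hmem : ∀ k n a, HasChain A R k n a → a ∈ A n := by
    intro k n a h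
    cases k with
    | zero => exact h
    | succ k => exact h.1
  have hanti : ∀ k n a, HasChain A R (k + 1) n a → HasChain A R k n a := by
    intro k
    induction k with
    | zero => exact fun n a h => h.1
    | succ k ih => exact fun n a h => ⟨h.1, h.2.imp fun b hb => ⟨hb.1, ih _ _ hb.2⟩⟩
  have hex : ∀ k n, ∃ a, HasChain A R k n a := by
    intro k
    induction k with
    | zero => exact hne
    | succ k ih =>
      intro n
      obtain ⟨b, hb⟩ := ih (n + 1)
      obtain ⟨a, ha, hab⟩ := hR n b (hmem _ _ _ hb)
      exact ⟨a, ha, b, hab, hb⟩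
  obtain ⟨a₀, ha₀⟩ := exists_mem_forall_of_antitone_finite (hfin 0)
    (S := fun k => {a | HasChain A R k 0 a}) (antitone_nat_of_succ_le fun k a => hanti k 0 a)
    (fun k a => hmem k 0 a) (fun k => hex k 0)
  have hstep : ∀ n a, (∀ k, HasChain A R k n a) →
      ∃ b, R a b ∧ ∀ k, HasChain A R k (n + 1) b := by
    intro n a ha
    obtain ⟨b, hb⟩ := exists_mem_forall_of_antitone_finite (hfin (n + 1))
      (S := fun k => {b | R a b ∧ HasChain A R k (n + 1) b})
      (antitone_nat_of_succ_le fun k b hb => ⟨hb.1, hanti k _ b hb.2⟩)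
      (fun k b hb => hmem k _ b hb.2) (fun k => (ha (k + 1)).2)
    exact ⟨b, (hb 0).1, fun k => (hb k).2⟩
  choose! next hnext using hstep
  let a : ℕ → α := fun n => Nat.rec a₀ (fun n b => next n b) n
  have ha : ∀ n k, HasChain A R k n (a n) := by
    intro n
    induction n with
    | zero => exact ha₀
    | succ n ih => exact (hnext n (a n) ih).2
  exact ⟨a, fun n => ⟨ha n 0, (hnext n (a n) (ha n)).1⟩⟩

/-! ### Compactoid sequences of open sets -/

/-- A decreasing sequence of open sets such that every ultrafilter containing all of them converges
to a point of their intersection. -/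
structure IsCompactoidSeq {X : Type u} [TopologicalSpace X] (V : ℕ → Opens X) : Prop where
  antitone : Antitone V
  exists_le_nhds : ∀ F : Ultrafilter X, (∀ n, (V n : Set X) ∈ F) →
    ∃ x, (∀ n, x ∈ V n) ∧ (F : Filter X) ≤ 𝓝 x

namespace IsCompactoidSeq

variable {X : Type u} [TopologicalSpace X] {V : ℕ → Opens X}

/-- The intersection of a compactoid sequence is compact, even after adding compact sets `K m` that
eventually enter every member of the sequence. -/
theorem isCompact_union (hV : IsCompactoidSeq V) {K : ℕ → Set X} (hK : ∀ m, IsCompact (K m))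
    (hKV : ∀ n, ∀ᶠ m in atTop, K m ⊆ V n) :
    IsCompact ((⋂ n, (V n : Set X)) ∪ ⋃ m, K m) := by
  refine isCompact_iff_ultrafilter_le_nhds'.2 fun F hF => ?_
  by_cases h : ∀ n, (V n : Set X) ∈ F
  · obtain ⟨x, hx, hFx⟩ := hV.exists_le_nhds F h
    exact ⟨x, Or.inl (Set.mem_iInter.2 hx), hFx⟩
  -- otherwise `F` avoids some `V n`, and hence lives on finitely many of the sets `K m`
  · obtain ⟨n, hn⟩ := not_forall.1 h
    obtain ⟨M, hM⟩ := eventually_atTop.1 (hKV n)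
    have hfin : (⋃ m ∈ Set.Iio M, K m) ∈ F := by
      filter_upwards [hF, Ultrafilter.compl_mem_iff_notMem.2 hn] with x hx hxn
      rcases hx with hx | hx
      · exact absurd (Set.mem_iInter.1 hx n) hxn
      · obtain ⟨m, hm⟩ := Set.mem_iUnion.1 hx
        refine Set.mem_biUnion (x := m) (Set.mem_Iio.2 (lt_of_not_ge fun hMm => ?_)) hm
        exact hxn (hM m hMm hm)
    obtain ⟨m, -, hm⟩ := (Ultrafilter.finite_biUnion_mem_iff (Set.finite_Iio M)).1 hfin
    obtain ⟨x, hx, hFx⟩ := isCompact_iff_ultrafilter_le_nhds'.1 (hK m) F hm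
    exact ⟨x, Or.inr (Set.mem_iUnion.2 ⟨m, hx⟩), hFx⟩

theorem isCompact_iInter (hV : IsCompactoidSeq V) : IsCompact (⋂ n, (V n : Set X)) := by
  simpa using hV.isCompact_union (K := fun _ => ∅) (fun _ => isCompact_empty) (by simp)

theorem exists_le (hV : IsCompactoidSeq V) {W : Opens X} (hW : (⋂ n, (V n : Set X)) ⊆ W) :
    ∃ n, V n ≤ W := by
  by_contra! h
  have hne : (⨅ n, 𝓟 ((V n : Set X) \ W)).NeBot := by
    refine iInf_neBot_of_directed' (Antitone.directed_ge fun m n hmn => ?_) fun n => ?_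
    · exact principal_mono.2 (Set.sdiff_subset_sdiff_left (hV.antitone hmn))
    · exact principal_neBot_iff.2 (Set.sdiff_nonempty.2 (h n))
  let F := Ultrafilter.of (⨅ n, 𝓟 ((V n : Set X) \ W))
  have hF : ∀ n, (V n : Set X) \ W ∈ F := fun n =>
    Ultrafilter.of_le _ (mem_iInf_of_mem n (mem_principal_self _))
  obtain ⟨x, hx, hFx⟩ := hV.exists_le_nhds F fun n => mem_of_superset (hF n) Set.sdiff_subset
  have hxW : (W : Set X) ∈ F := hFx (W.isOpen.mem_nhds (hW (Set.mem_iInter.2 hx)))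
  obtain ⟨y, hy1, hy2⟩ := F.nonempty_of_mem (inter_mem hxW (hF 0))
  exact hy2.2 hy1

end IsCompactoidSeq

/-! ### Consonance of quasi-Polish spaces -/

namespace QuasiMetric

variable {X : Type u} (d : QuasiMetric X)

theorem qdist_self (x : X) : d.qdist x x = 0 := ((d.eq_iff x x).1 rfl).1

/-- `d.Inside p q`: the ball `q` lies inside the ball `p` with a margin of its own radius. The
margin ensures that `p` contains the limits of sequences in `q`. -/
def Inside (p q : X × ℝ) : Prop := d.qdist p.1 q.1 + 2 * q.2 < p.2

theorem Inside.ball_subset {d : QuasiMetric X} {p q : X × ℝ} (h : d.Inside p q) (hq : 0 < q.2) :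
    d.ball q.1 q.2 ⊆ d.ball p.1 p.2 := by
  intro z hz
  have h1 : d.qdist q.1 z < q.2 := hz
  have h2 := d.triangle p.1 q.1 z
  have h3 : d.qdist p.1 q.1 + 2 * q.2 < p.2 := h
  change d.qdist p.1 z < p.2
  linarith

variable [t : TopologicalSpace X]

theorem isOpen_ball (hd : t = d.topology) (x : X) (r : ℝ) : IsOpen (d.ball x r) := by
  subst hd
  intro y hy
  refine ⟨r - d.qdist x y, sub_pos.2 hy, fun z hz => ?_⟩
  have h1 : d.qdist y z < r - d.qdist x y := hz
  have h2 := d.triangle x y z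
  change d.qdist x z < r
  linarith

theorem exists_ball_subset (hd : t = d.topology) {U : Set X} (hU : IsOpen U) {x : X}
    (hx : x ∈ U) : ∃ r, 0 < r ∧ d.ball x r ⊆ U := by
  subst hd
  exact hU x hx

/-- The ball with a given centre and radius, as an open set. -/
def ballOpens (hd : t = d.topology) (p : X × ℝ) : Opens X :=
  ⟨d.ball p.1 p.2, d.isOpen_ball hd p.1 p.2⟩

/-- The union of a set of balls, each given by its centre and radius. -/
def unionBalls (hd : t = d.topology) (F : Set (X × ℝ)) : Opens X :=
  ⨆ p ∈ F, d.ballOpens hd p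

theorem mem_unionBalls (hd : t = d.topology) {F : Set (X × ℝ)} {x : X} :
    x ∈ d.unionBalls hd F ↔ ∃ p ∈ F, d.qdist p.1 x < p.2 := by
  simp [unionBalls, ballOpens, ball]

theorem exists_finite_balls (hd : t = d.topology) {s : Set (OpenLattice X)} (hs : IsOpen s)
    {U : Opens X} (hU : toScott U ∈ s) {Q : Set (X × ℝ)}
    (hQ : ∀ x ∈ U, ∃ r, 0 < r ∧ (x, r) ∈ Q) :
    ∃ F ⊆ Q, F.Finite ∧ toScott (d.unionBalls hd F) ∈ s := by
  obtain ⟨T, hT⟩ := OpenLattice.exists_finset_iSup_mem hs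
    (W := fun q : Q => d.ballOpens hd q) hU (fun x hx => by
      obtain ⟨r, hr, hxr⟩ := hQ x hx
      refine Opens.mem_iSup.2 ⟨⟨(x, r), hxr⟩, ?_⟩
      change d.qdist x x < r
      rwa [d.qdist_self])
  refine ⟨(↑) '' (T : Set Q), ?_, T.finite_toSet.image _, OpenLattice.mem_of_le hs ?_ hT⟩
  · rintro _ ⟨q, -, rfl⟩
    exact q.2
  · refine iSup₂_le fun q hq x hx => (d.mem_unionBalls hd).2 ⟨q, ⟨q, hq, rfl⟩, hx⟩

/-- A nested sequence of balls with radii tending to zero shrinks, along any filter containing all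
of them, to a point of their intersection. This is where Smyth-completeness is used. -/
theorem SmythComplete.exists_le_nhds_of_inside {d : QuasiMetric X} (hc : d.SmythComplete)
    (hd : t = d.topology) {a : ℕ → X × ℝ} (hpos : ∀ n, 0 < (a n).2)
    (hin : ∀ n, d.Inside (a n) (a (n + 1))) (hr : Tendsto (fun n => (a n).2) atTop (𝓝 0))
    {F : Filter X} (hF : ∀ n, d.ball (a n).1 (a n).2 ∈ F) :
    ∃ x, (∀ n, d.qdist (a n).1 x < (a n).2) ∧ F ≤ 𝓝 x := by
  have hanti : Antitone fun n => d.ball (a n).1 (a n).2 :=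
    antitone_nat_of_succ_le fun n => (hin n).ball_subset (hpos _)
  have hmem : ∀ n m, n ≤ m → d.qdist (a n).1 (a m).1 < (a n).2 := fun n m hnm =>
    hanti hnm (show d.qdist (a m).1 (a m).1 < (a m).2 by rw [d.qdist_self]; exact hpos m)
  have hsmall : ∀ ε : ℝ, 0 < ε → ∀ᶠ n in atTop, (a n).2 < ε := fun ε hε =>
    hr.eventually (gt_mem_nhds hε)
  obtain ⟨x, hx⟩ := hc (fun n => (a n).1) fun ε hε => by
    obtain ⟨N, hN⟩ := eventually_atTop.1 (hsmall ε hε)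
    exact ⟨N, fun n m hn hnm => (hmem n m hnm).trans (hN n hn)⟩
  have hx' : ∀ ε : ℝ, 0 < ε → ∀ᶠ n in atTop, max (d.qdist x (a n).1) (d.qdist (a n).1 x) < ε :=
    fun ε hε => hx.eventually (gt_mem_nhds hε)
  refine ⟨x, fun n => ?_, fun s hs => ?_⟩
  · obtain ⟨m, hm, hnm⟩ := ((hx' _ (hpos (n + 1))).and (eventually_ge_atTop (n + 1))).exists
    have h1 := (max_lt_iff.1 hm).2
    have h2 := hmem (n + 1) m hnm
    have h3 : d.qdist (a n).1 (a (n + 1)).1 + 2 * (a (n + 1)).2 < (a n).2 := hin n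
    have h4 := d.triangle (a n).1 (a (n + 1)).1 x
    have h5 := d.triangle (a (n + 1)).1 (a m).1 x
    linarith
  · obtain ⟨U, hUs, hU, hxU⟩ := mem_nhds_iff.1 hs
    obtain ⟨r, hr0, hrU⟩ := d.exists_ball_subset hd hU hxU
    obtain ⟨n, hn, hn'⟩ := ((hx' _ (half_pos hr0)).and (hsmall _ (half_pos hr0))).exists
    refine mem_of_superset (hF n) fun y hy => hUs (hrU ?_)
    have h1 := (max_lt_iff.1 hn).1
    have h2 : d.qdist (a n).1 y < (a n).2 := hy
    have h3 := d.triangle x (a n).1 y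
    change d.qdist x y < r
    linarith

/-- The members of the sequence are finite unions of balls, each ball of one stage lying inside a
ball of the previous stage. An ultrafilter containing the sequence selects, by Kőnig's lemma, a
nested sequence of balls, and converges to its limit. -/
theorem SmythComplete.exists_isCompactoidSeq {d : QuasiMetric X} (hc : d.SmythComplete)
    (hd : t = d.topology) {s : Set (OpenLattice X)} (hs : IsOpen s) {U : Opens X}
    (hU : toScott U ∈ s) :
    ∃ V : ℕ → Opens X, IsCompactoidSeq V ∧ V 0 ≤ U ∧ ∀ n, toScott (V n) ∈ s := by
  let Good : Set (X × ℝ) → Prop := fun F =>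
    F.Finite ∧ (∀ p ∈ F, 0 < p.2) ∧ toScott (d.unionBalls hd F) ∈ s
  have hstart : ∃ F, Good F ∧ d.unionBalls hd F ≤ U := by
    obtain ⟨F, hFQ, hF, hFs⟩ := d.exists_finite_balls hd hs hU
      (Q := {p | 0 < p.2 ∧ d.ball p.1 p.2 ⊆ U}) fun x hx => by
        obtain ⟨r, hr, hrU⟩ := d.exists_ball_subset hd U.isOpen hx
        exact ⟨r, hr, hr, hrU⟩
    exact ⟨F, ⟨hF, fun p hp => (hFQ hp).1, hFs⟩, iSup₂_le fun p hp => (hFQ hp).2⟩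
  have hnext : ∀ (F : {F // Good F}) (n : ℕ), ∃ F' : {F // Good F}, ∀ q ∈ F'.1,
      q.2 ≤ (1 / 2 : ℝ) ^ n ∧ ∃ p ∈ F.1, d.Inside p q := by
    rintro ⟨F, -, -, hFs⟩ n
    obtain ⟨F', hFQ, hF', hFs'⟩ := d.exists_finite_balls hd hs hFs
      (Q := {q | 0 < q.2 ∧ q.2 ≤ (1 / 2 : ℝ) ^ n ∧ ∃ p ∈ F, d.Inside p q}) fun x hx => by
        obtain ⟨p, hp, hpx⟩ := (d.mem_unionBalls hd).1 hx
        have h1 : 0 < (p.2 - d.qdist p.1 x) / 3 := by linarith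
        have h2 : (0 : ℝ) < (1 / 2 : ℝ) ^ n := by positivity
        refine ⟨min ((p.2 - d.qdist p.1 x) / 3) ((1 / 2 : ℝ) ^ n), lt_min h1 h2, lt_min h1 h2,
          min_le_right _ _, p, hp, ?_⟩
        have h3 := min_le_left ((p.2 - d.qdist p.1 x) / 3) ((1 / 2 : ℝ) ^ n)
        change d.qdist p.1 x + 2 * _ < p.2
        linarith
    exact ⟨⟨F', hF', fun p hp => (hFQ hp).1, hFs'⟩, fun q hq => (hFQ hq).2⟩
  obtain ⟨F₀, hF₀, hF₀U⟩ := hstart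
  choose next hnext using hnext
  let F : ℕ → {F // Good F} := fun n => Nat.rec ⟨F₀, hF₀⟩ (fun n F => next F n) n
  have hF : ∀ n, ∀ q ∈ (F (n + 1)).1, q.2 ≤ (1 / 2 : ℝ) ^ n ∧ ∃ p ∈ (F n).1, d.Inside p q :=
    fun n => hnext (F n) n
  refine ⟨fun n => d.unionBalls hd (F n).1, ⟨?_, fun 𝓕 h𝓕 => ?_⟩, hF₀U, fun n => (F n).2.2.2⟩
  · refine antitone_nat_of_succ_le fun n x hx => ?_
    obtain ⟨q, hq, hqx⟩ := (d.mem_unionBalls hd).1 hx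
    obtain ⟨-, p, hp, hpq⟩ := hF n q hq
    exact (d.mem_unionBalls hd).2 ⟨p, hp, hpq.ball_subset ((F (n + 1)).2.2.1 q hq) hqx⟩
  · obtain ⟨a, ha⟩ := exists_branch (A := fun n => {p | p ∈ (F n).1 ∧ d.ball p.1 p.2 ∈ 𝓕})
      (R := d.Inside) (fun n => (F n).2.1.subset fun p hp => hp.1)
      (fun n => by
        have h : (⋃ p ∈ (F n).1, d.ball p.1 p.2) ∈ 𝓕 := by
          filter_upwards [h𝓕 n] with x hx
          obtain ⟨p, hp, hpx⟩ := (d.mem_unionBalls hd).1 hx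
          exact Set.mem_biUnion hp hpx
        exact (Ultrafilter.finite_biUnion_mem_iff (F n).2.1).1 h)
      (fun n q hq => by
        obtain ⟨-, p, hp, hpq⟩ := hF n q hq.1
        exact ⟨p, ⟨hp, mem_of_superset hq.2 (hpq.ball_subset ((F (n + 1)).2.2.1 q hq.1))⟩, hpq⟩)
    have hpos : ∀ n, 0 < (a n).2 := fun n => (F n).2.2.1 _ (ha n).1.1
    obtain ⟨x, hx, h𝓕x⟩ := hc.exists_le_nhds_of_inside hd hpos (fun n => (ha n).2)
      ((tendsto_add_atTop_iff_nat 1).1 <| squeeze_zero (fun n => (hpos _).le)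
        (fun n => (hF n _ (ha (n + 1)).1.1).1)
        (tendsto_pow_atTop_nhds_zero_of_lt_one (by norm_num) (by norm_num)))
      (F := 𝓕) (fun n => (ha n).1.2)
    exact ⟨x, fun n => (d.mem_unionBalls hd).2 ⟨a n, (ha n).1.1, hx n⟩, h𝓕x⟩

end QuasiMetric

theorem QuasiPolish.exists_isCompactoidSeq {X : Type u} [TopologicalSpace X] (hX : QuasiPolish X)
    {s : Set (OpenLattice X)} (hs : IsOpen s) {U : Opens X} (hU : toScott U ∈ s) :
    ∃ V : ℕ → Opens X, IsCompactoidSeq V ∧ V 0 ≤ U ∧ ∀ n, toScott (V n) ∈ s := by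
  obtain ⟨-, d, hc, hd⟩ := hX
  exact hc.exists_isCompactoidSeq hd hs hU

/-- Quasi-Polish spaces are consonant. -/
theorem QuasiPolish.exists_isCompact {X : Type u} [TopologicalSpace X] (hX : QuasiPolish X)
    {s : Set (OpenLattice X)} (hs : IsOpen s) {U : Opens X} (hU : toScott U ∈ s) :
    ∃ K : Set X, IsCompact K ∧ K ⊆ U ∧ ∀ W : Opens X, K ⊆ W → toScott W ∈ s := by
  obtain ⟨V, hV, hVU, hVs⟩ := hX.exists_isCompactoidSeq hs hU
  refine ⟨_, hV.isCompact_iInter, (Set.iInter_subset _ 0).trans hVU, fun W hW => ?_⟩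
  obtain ⟨n, hn⟩ := hV.exists_le hW
  exact OpenLattice.mem_of_le hs hn (hVs n)

/-! ### First countability of `O(X)` forces local compactness -/

theorem QuasiPolish.locallyCompactSpace {X : Type u} [TopologicalSpace X] (hX : QuasiPolish X)
    [FirstCountableTopology (OpenLattice X)] : LocallyCompactSpace X := by
  have := hX.1
  refine ⟨fun x n hn => ?_⟩
  obtain ⟨U, hUn, hU, hxU⟩ := mem_nhds_iff.1 hn
  lift U to Opens X using hU
  obtain ⟨V, hV⟩ := (𝓝 x).exists_antitone_basis
  obtain ⟨H, hH⟩ := (𝓝 (toScott U : OpenLattice X)).exists_antitone_basis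
  -- some basic neighbourhood of `x` is contained in all open sets close to `U`
  obtain ⟨k, hk⟩ : ∃ k, ∀ W : Opens X, toScott W ∈ H k → V k ⊆ W := by
    by_contra! h
    choose W hWH hVW using h
    choose y hyV hyW using fun k => Set.not_subset.1 (hVW k)
    have hy : Tendsto y atTop (𝓝 x) := hV.tendsto hyV
    obtain ⟨m, hm⟩ := eventually_atTop.1 (hy.eventually (U.isOpen.mem_nhds hxU))
    have hK := ((tendsto_add_atTop_iff_nat m).2 hy).isCompact_insert_range
    have hKU : insert x (Set.range fun k => y (k + m)) ⊆ U := by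
      rintro _ (rfl | ⟨k, rfl⟩)
      · exact hxU
      · exact hm _ (Nat.le_add_left m k)
    obtain ⟨N, hN⟩ := hH.mem_iff.1 ((OpenLattice.isOpen_setOf_subset hK).mem_nhds hKU)
    have hsub : insert x (Set.range fun k => y (k + m)) ⊆ (W (N + m) : Set X) :=
      hN (hH.antitone (Nat.le_add_right N m) (hWH (N + m)))
    exact hyW (N + m) (hsub (Or.inr ⟨N, rfl⟩))
  obtain ⟨s, hsH, hs, hUs⟩ := mem_nhds_iff.1 (hH.mem k)
  obtain ⟨K, hK, hKU, hKs⟩ := hX.exists_isCompact hs hUs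
  refine ⟨nhdsKer K, mem_of_superset (hV.mem k) ?_, ?_, hK.nhdsKer⟩
  · refine subset_nhdsKer_iff.2 fun W hW hKW => hk ⟨W, hW⟩ (hsH (hKs ⟨W, hW⟩ hKW))
  · exact (nhdsKer_minimal hKU U.isOpen).trans hUn

/-! ### Open sets of a locally compact space -/

/-- `U` is contained in a compact subset of `V`. In a locally compact space, this is the way-below
relation of the lattice of open sets. -/
def CompactlyBelow {X : Type u} [TopologicalSpace X] (U V : Opens X) : Prop :=
  ∃ K : Set X, IsCompact K ∧ (U : Set X) ⊆ K ∧ K ⊆ V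

namespace CompactlyBelow

variable {X : Type u} [TopologicalSpace X]

theorem le {U V : Opens X} : CompactlyBelow U V → U ≤ V :=
  fun ⟨_, _, hUK, hKV⟩ => Set.Subset.trans hUK hKV

theorem mono_right {U V W : Opens X} (h : CompactlyBelow U V) (hVW : V ≤ W) :
    CompactlyBelow U W := by
  obtain ⟨K, hK, hUK, hKV⟩ := h
  exact ⟨K, hK, hUK, hKV.trans hVW⟩

protected theorem bot (V : Opens X) : CompactlyBelow ⊥ V :=
  ⟨∅, isCompact_empty, le_rfl, Set.empty_subset _⟩

protected theorem sup {U U' V : Opens X} (h : CompactlyBelow U V) (h' : CompactlyBelow U' V) :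
    CompactlyBelow (U ⊔ U') V := by
  obtain ⟨K, hK, hUK, hKV⟩ := h
  obtain ⟨K', hK', hUK', hKV'⟩ := h'
  exact ⟨K ∪ K', hK.union hK', Set.union_subset_union hUK hUK', Set.union_subset hKV hKV'⟩

theorem isOpen_setOf (U : Opens X) : IsOpen {V : OpenLattice X | CompactlyBelow U (ofScott V)} := by
  have h : {V : OpenLattice X | CompactlyBelow U (ofScott V)} =
      ⋃ K ∈ {K : Set X | IsCompact K ∧ (U : Set X) ⊆ K},
        {V : OpenLattice X | K ⊆ (ofScott V : Opens X)} := by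
    ext V
    simp [CompactlyBelow, and_assoc]
  rw [h]
  exact isOpen_biUnion fun K hK => OpenLattice.isOpen_setOf_subset hK.1

theorem exists_between [LocallyCompactSpace X] {B : ℕ → Opens X} (hB : IsUnionBasis B)
    {U V : Opens X} (h : CompactlyBelow U V) :
    ∃ n, CompactlyBelow U (B n) ∧ CompactlyBelow (B n) V := by
  obtain ⟨K, hK, hUK, hKV⟩ := h
  obtain ⟨L, hL, hKL, hLV⟩ := exists_compact_between hK V.isOpen hKV
  obtain ⟨n, hKn, hnL⟩ := hB.exists_between hK (U := ⟨interior L, isOpen_interior⟩) hKL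
  exact ⟨n, ⟨K, hK, hUK, hKn⟩, ⟨L, hL, Set.Subset.trans hnL interior_subset, hLV⟩⟩

end CompactlyBelow

namespace OpenLattice

variable {X : Type u} [TopologicalSpace X] [LocallyCompactSpace X]

theorem exists_compactlyBelow_mem {s : Set (OpenLattice X)} (hs : IsOpen s) {U : Opens X}
    (hU : toScott U ∈ s) : ∃ V, CompactlyBelow V U ∧ toScott V ∈ s := by
  have : Nonempty {V : Opens X // CompactlyBelow V U} := ⟨⟨⊥, .bot U⟩⟩
  obtain ⟨V, hV⟩ := exists_mem_of_le_iSup hs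
    (W := fun V : {V : Opens X // CompactlyBelow V U} => (V : Opens X))
    (fun V V' => ⟨⟨V.1 ⊔ V'.1, V.2.sup V'.2⟩, le_sup_left, le_sup_right⟩) hU (fun x hx => by
      obtain ⟨K, hK, hKU, hKc⟩ := local_compact_nhds (U.isOpen.mem_nhds hx)
      exact Opens.mem_iSup.2 ⟨⟨⟨interior K, isOpen_interior⟩, K, hKc, interior_subset, hKU⟩,
        mem_interior_iff_mem_nhds.2 hK⟩)
  exact ⟨V, V.2, hV⟩

theorem exists_basis_compactlyBelow_mem {B : ℕ → Opens X} (hB : IsUnionBasis B)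
    {s : Set (OpenLattice X)} (hs : IsOpen s) {U : Opens X} (hU : toScott U ∈ s) :
    ∃ n, CompactlyBelow (B n) U ∧ toScott (B n) ∈ s := by
  obtain ⟨V, hVU, hV⟩ := exists_compactlyBelow_mem hs hU
  obtain ⟨n, hVn, hnU⟩ := hVU.exists_between hB
  exact ⟨n, hnU, mem_of_le hs hVn.le hV⟩

/-- A principal filter of open sets is Scott-compact, and the principal filters of the open sets
compactly below `U` form a neighbourhood basis at `U`. -/
theorem locallyCompactSpace : LocallyCompactSpace (OpenLattice X) := by
  refine ⟨fun U n hn => ?_⟩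
  obtain ⟨s, hsn, hs, hUs⟩ := mem_nhds_iff.1 hn
  obtain ⟨V, hVU, hV⟩ := exists_compactlyBelow_mem hs (U := ofScott U) hUs
  refine ⟨{W : OpenLattice X | V ≤ ofScott W}, ?_, ?_, ?_⟩
  · exact mem_of_superset ((CompactlyBelow.isOpen_setOf V).mem_nhds hVU) fun W hW => hW.le
  · exact fun W hW => hsn (mem_of_le hs hW hV)
  · refine isCompact_iff_ultrafilter_le_nhds'.2 fun F hF =>
      ⟨toScott V, le_rfl (a := V), fun o ho => ?_⟩
    obtain ⟨o', ho', hoo', hVo'⟩ := mem_nhds_iff.1 ho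
    exact mem_of_superset hF fun W hW => ho' (mem_of_le hoo' hW hVo')

theorem secondCountableTopology [SecondCountableTopology X] :
    SecondCountableTopology (OpenLattice X) := by
  obtain ⟨B, hB⟩ := exists_isUnionBasis X
  refine (TopologicalSpace.isTopologicalBasis_of_isOpen_of_nhds
    (s := Set.range fun n => {V : OpenLattice X | CompactlyBelow (B n) (ofScott V)})
    ?_ ?_).secondCountableTopology (Set.countable_range _)
  · rintro _ ⟨n, rfl⟩
    exact CompactlyBelow.isOpen_setOf (B n)
  · intro U s hU hs
    obtain ⟨n, hnU, hn⟩ := exists_basis_compactlyBelow_mem hB hs (U := ofScott U) hU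
    exact ⟨_, ⟨n, rfl⟩, hnU, fun W hW => mem_of_le hs hW.le hn⟩

end OpenLattice

/-! ### The double lattice `O(O(X))` is countably based -/

namespace QuasiPolish

variable {X : Type u} [TopologicalSpace X]

/-- For `U ∈ 𝓗`, take a compactoid sequence `V` inside `𝓗` and below `U`. By consonance `𝓖 m`
contains all open neighbourhoods of a compact subset `K m` of `V (k m)`, where `k m` tends to
infinity; hence the intersection of the sequence together with all `K m` is compact, and its open
neighbourhoods belong to almost all `𝓖 m` simultaneously. -/
theorem le_iSup_iInf_of_eventually (hX : QuasiPolish X) {𝓗 : Opens (OpenLattice X)}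
    {𝓖 : ℕ → Opens (OpenLattice X)}
    (h : ∀ U : Opens X, toScott U ∈ 𝓗 → ∀ᶠ m in atTop, toScott U ∈ 𝓖 m) :
    𝓗 ≤ ⨆ n, ⨅ m ≥ n, 𝓖 m := by
  classical
  intro U hU
  obtain ⟨V, hV, hVU, hVH⟩ := hX.exists_isCompactoidSeq 𝓗.isOpen (U := ofScott U) hU
  have hK : ∀ m, ∃ K : Set X, IsCompact K ∧ K ⊆ V 0 ∧
      (∀ n ≤ m, toScott (V n) ∈ 𝓖 m → K ⊆ V n) ∧
      (toScott (V 0) ∈ 𝓖 m → ∀ W : Opens X, K ⊆ W → toScott W ∈ 𝓖 m) := by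
    intro m
    by_cases h0 : toScott (V 0) ∈ 𝓖 m
    · have hk := Nat.findGreatest_spec (P := fun n => toScott (V n) ∈ 𝓖 m) (Nat.zero_le m) h0
      obtain ⟨K, hKc, hKV, hKW⟩ := hX.exists_isCompact (𝓖 m).isOpen hk
      exact ⟨K, hKc, hKV.trans (hV.antitone (Nat.zero_le _)),
        fun n hnm hn => hKV.trans (hV.antitone (Nat.le_findGreatest hnm hn)), fun _ => hKW⟩
    · refine ⟨∅, isCompact_empty, Set.empty_subset _, fun n _ _ => Set.empty_subset _,
        fun h1 => absurd h1 h0⟩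
  choose K hKc hK0 hKV hKW using hK
  have hL := hV.isCompact_union hKc fun n => by
    filter_upwards [h _ (hVH n), eventually_ge_atTop n] with m hm hnm
    exact hKV m n hnm hm
  let 𝓛 : Opens (OpenLattice X) := ⟨_, OpenLattice.isOpen_setOf_subset hL⟩
  obtain ⟨N, hN⟩ := eventually_atTop.1 (h _ (hVH 0))
  have h𝓛 : 𝓛 ≤ ⨅ m ≥ N, 𝓖 m := le_iInf₂ fun m hm W hW =>
    hKW m (hN m hm) (ofScott W)
      ((Set.subset_iUnion K m).trans (Set.subset_union_right.trans hW))
  have hU𝓛 : U ∈ 𝓛 := Set.Subset.trans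
    (Set.union_subset (Set.iInter_subset _ 0) (Set.iUnion_subset hK0)) hVU
  exact Opens.mem_iSup.2 ⟨N, h𝓛 hU𝓛⟩

/-- The Scott topology of `O(O(X))` is the topology of pointwise convergence on a countable basis
of `X`. -/
theorem exists_forall_lt_mem (hX : QuasiPolish X) {B : ℕ → Opens X} (hB : IsUnionBasis B)
    {Φ : Set (OpenLattice (OpenLattice X))} (hΦ : IsOpen Φ) {𝓗 : Opens (OpenLattice X)}
    (h𝓗 : toScott 𝓗 ∈ Φ) :
    ∃ N, ∀ 𝓖 : Opens (OpenLattice X),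
      (∀ i < N, toScott (B i) ∈ 𝓗 → toScott (B i) ∈ 𝓖) → toScott 𝓖 ∈ Φ := by
  by_contra! h
  choose 𝓖 h𝓖 h𝓖Φ using h
  have hle : 𝓗 ≤ ⨆ n, ⨅ m ≥ n, 𝓖 m := hX.le_iSup_iInf_of_eventually fun U hU => by
    obtain ⟨i, hiU, hi⟩ := hB.exists_le_mem 𝓗.isOpen hU
    filter_upwards [eventually_gt_atTop i] with m hm
    exact OpenLattice.mem_of_le (𝓖 m).isOpen hiU (h𝓖 m i hm hi)
  obtain ⟨n, hn⟩ := OpenLattice.exists_mem_of_le_iSup hΦ (W := fun n => ⨅ m ≥ n, 𝓖 m)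
    (Monotone.directed_le fun a b hab => le_iInf₂ fun m hm => iInf₂_le m (hab.trans hm)) h𝓗 hle
  exact h𝓖Φ n (OpenLattice.mem_of_le hΦ (iInf₂_le n le_rfl) hn)

theorem secondCountableTopology_double (hX : QuasiPolish X) :
    SecondCountableTopology (OpenLattice (OpenLattice X)) := by
  classical
  have := hX.1
  obtain ⟨B, hB⟩ := exists_isUnionBasis X
  refine (TopologicalSpace.isTopologicalBasis_of_isOpen_of_nhds
    (s := Set.range fun F : Finset ℕ => ⋂ i ∈ F, {𝓖 : OpenLattice (OpenLattice X) |
      (toScott (B i) : OpenLattice X) ∈ (ofScott 𝓖 : Opens (OpenLattice X))})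
    ?_ ?_).secondCountableTopology (Set.countable_range _)
  · rintro _ ⟨F, rfl⟩
    exact isOpen_biInter_finset fun i _ => OpenLattice.isOpen_setOf_mem _
  · intro 𝓗 Φ h𝓗 hΦ
    obtain ⟨N, hN⟩ := hX.exists_forall_lt_mem hB hΦ (𝓗 := ofScott 𝓗) h𝓗
    refine ⟨_, ⟨(Finset.range N).filter fun i =>
      (toScott (B i) : OpenLattice X) ∈ (ofScott 𝓗 : Opens (OpenLattice X)), rfl⟩, ?_, ?_⟩
    · exact Set.mem_iInter₂.2 fun i hi => (Finset.mem_filter.1 hi).2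
    · exact fun 𝓖 h𝓖 => hN (ofScott 𝓖) fun i hi hi𝓗 =>
        Set.mem_iInter₂.1 h𝓖 i (Finset.mem_filter.2 ⟨Finset.mem_range.2 hi, hi𝓗⟩)

end QuasiPolish

/-! ### `O(X)` as a retract of `O(O(O(X)))` -/

namespace OpenLattice

variable {X : Type u} [TopologicalSpace X]

/-- The Scott-open family of all open neighbourhoods of a point. -/
def nhdsFamily (x : X) : OpenLattice (OpenLattice X) :=
  toScott ⟨_, isOpen_setOf_mem x⟩

theorem continuous_nhdsFamily (hX : QuasiPolish X) :
    Continuous (nhdsFamily : X → OpenLattice (OpenLattice X)) := by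
  have := hX.1
  obtain ⟨B, hB⟩ := exists_isUnionBasis X
  refine continuous_def.2 fun Φ hΦ => isOpen_iff_mem_nhds.2 fun x hx => ?_
  obtain ⟨N, hN⟩ := hX.exists_forall_lt_mem hB hΦ (𝓗 := ofScott (nhdsFamily x)) hx
  have h : ∀ᶠ y in 𝓝 x, ∀ i ∈ Set.Iio N, x ∈ B i → y ∈ B i :=
    (eventually_all_finite (Set.finite_Iio N)).2 fun i _ => by
      by_cases hi : x ∈ B i
      · exact ((B i).isOpen.eventually_mem hi).mono fun y hy _ => hy
      · exact Eventually.of_forall fun y hx => absurd hx hi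
  filter_upwards [h] with y hy
  exact hN (ofScott (nhdsFamily y)) hy

/-- Here no assumption on `X` is needed: a Scott-open family of open sets containing a directed
union contains one of its members. -/
theorem continuous_nhdsFamily_openLattice :
    Continuous (nhdsFamily : OpenLattice X → OpenLattice (OpenLattice (OpenLattice X))) := by
  refine continuous_def.2 fun s hs => isOpen_iff.2 ⟨fun U V hUV hU => ?_, fun S hS hdir hsup => ?_⟩
  · exact mem_of_le hs (fun 𝓗 h𝓗 => mem_of_le (ofScott 𝓗).isOpen hUV h𝓗) hU
  · have := hS.to_subtype
    obtain ⟨V, hV⟩ := exists_mem_of_le_iSup hs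
      (W := fun V : S => ofScott (nhdsFamily (toScott (V : Opens X)))) (by
        intro V W
        obtain ⟨Z, hZ, h1, h2⟩ := hdir V V.2 W W.2
        exact ⟨⟨Z, hZ⟩, fun 𝓗 h𝓗 => mem_of_le (ofScott 𝓗).isOpen h1 h𝓗,
          fun 𝓗 h𝓗 => mem_of_le (ofScott 𝓗).isOpen h2 h𝓗⟩) hsup (by
        intro 𝓗 h𝓗
        obtain ⟨V, hVS, hV⟩ := (isOpen_iff.1 (ofScott 𝓗).isOpen).2 S hS hdir h𝓗
        exact Opens.mem_iSup.2 ⟨⟨V, hVS⟩, hV⟩)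
    exact ⟨V, V.2, hV⟩

/-- A retraction sends `Ψ` to the set of points whose neighbourhood family belongs to `Ψ`. -/
theorem isEmbedding_nhdsFamily (hX : QuasiPolish X) :
    IsEmbedding (nhdsFamily : OpenLattice X → OpenLattice (OpenLattice (OpenLattice X))) :=
  Function.LeftInverse.isEmbedding
    (f := fun Ψ => toScott (Opens.comap ⟨nhdsFamily, continuous_nhdsFamily hX⟩ (ofScott Ψ)))
    (fun _ => rfl) (continuous_comap _) continuous_nhdsFamily_openLattice

end OpenLattice

/-! ### Quasi-metrics from ranks -/

section Rank

variable {Y : Type u} (m : ℕ → Y → ℕ∞)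

open Classical in
/-- The distance attached to a sequence of ranks: `1 / (n + 1)` for the first index `n` at which
the rank increases from `x` to `y`, and `0` if there is none. -/
noncomputable def rankDist (x y : Y) : ℝ :=
  if h : ∃ n, m n x < m n y then 1 / ((Nat.find h : ℝ) + 1) else 0

theorem rankDist_lt_iff {x y : Y} {N : ℕ} :
    rankDist m x y < 1 / ((N : ℝ) + 1) ↔ ∀ n ≤ N, m n y ≤ m n x := by
  classical
  unfold rankDist
  split_ifs with h
  · rw [one_div_lt_one_div (by positivity) (by positivity), add_lt_add_iff_right, Nat.cast_lt,
      Nat.lt_find_iff]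
    simp only [not_lt]
  · push Not at h
    exact iff_of_true (by positivity) fun n _ => h n

theorem rankDist_nonneg (x y : Y) : 0 ≤ rankDist m x y := by
  classical
  unfold rankDist
  split_ifs <;> positivity

theorem rankDist_eq_zero_iff {x y : Y} : rankDist m x y = 0 ↔ ∀ n, m n y ≤ m n x := by
  constructor
  · intro h n
    exact (rankDist_lt_iff m (N := n)).1 (by rw [h]; positivity) n le_rfl
  · intro h
    simp [rankDist, h]

theorem rankDist_le_max (x y z : Y) :
    rankDist m x z ≤ max (rankDist m x y) (rankDist m y z) := by
  classical
  by_cases h : ∃ n, m n x < m n z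
  · have hx : rankDist m x z = 1 / ((Nat.find h : ℝ) + 1) := by
      unfold rankDist
      rw [dif_pos h]
    by_contra! hlt
    rw [hx, max_lt_iff, rankDist_lt_iff, rankDist_lt_iff] at hlt
    exact absurd (Nat.find_spec h)
      (not_lt.2 ((hlt.2 _ le_rfl).trans (hlt.1 _ le_rfl)))
  · have hx : rankDist m x z = 0 := by
      unfold rankDist
      rw [dif_neg h]
    rw [hx]
    exact le_max_of_le_left (rankDist_nonneg m x y)

/-- The quasi-metric of a sequence of ranks that separates points. -/
noncomputable def rankQuasiMetric (hinj : ∀ x y, (∀ n, m n x = m n y) → x = y) :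
    QuasiMetric Y where
  qdist := rankDist m
  nonneg := rankDist_nonneg m
  eq_iff x y := by
    simp only [rankDist_eq_zero_iff]
    exact ⟨by rintro rfl; simp, fun h => hinj x y fun n => le_antisymm (h.2 n) (h.1 n)⟩
  triangle x y z := (rankDist_le_max m x y z).trans
    (max_le_add_of_nonneg (rankDist_nonneg m x y) (rankDist_nonneg m y z))

/-- A space is quasi-Polish if its topology is generated by a separating sequence of ranks in `ℕ∞`
and every sequence along which all ranks stabilize has a point realizing the limiting ranks.
Along a Cauchy sequence every rank is eventually nonincreasing, hence eventually constant. -/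
theorem quasiPolish_of_rank [t : TopologicalSpace Y] [SecondCountableTopology Y]
    (hinj : ∀ x y, (∀ n, m n x = m n y) → x = y)
    (hopen : ∀ n x, IsOpen {y | m n y ≤ m n x})
    (hbasis : ∀ s : Set Y, IsOpen s → ∀ x ∈ s, ∃ n, ∀ y, m n y ≤ m n x → y ∈ s)
    (hlim : ∀ w : ℕ → Y, (∀ n, ∃ c, ∀ᶠ k in atTop, m n (w k) = c) →
      ∃ y, ∀ n, ∀ᶠ k in atTop, m n (w k) = m n y) : QuasiPolish Y := by
  refine ⟨inferInstance, rankQuasiMetric m hinj, fun w hw => ?_, ?_⟩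
  · obtain ⟨y, hy⟩ := hlim w fun n => by
      obtain ⟨K, hK⟩ := hw (1 / ((n : ℝ) + 1)) (by positivity)
      obtain ⟨_, ⟨a, ha, rfl⟩, hmin⟩ := wellFounded_lt.has_min ((fun k => m n (w k)) '' Set.Ici K)
        (Set.nonempty_Ici.image _)
      refine ⟨m n (w a), eventually_atTop.2 ⟨a, fun b hab => le_antisymm ?_ ?_⟩⟩
      · exact (rankDist_lt_iff m).1 (hK a b ha hab) n le_rfl
      · exact not_lt.1 (hmin _ ⟨b, le_trans ha hab, rfl⟩)
    refine ⟨y, Metric.tendsto_nhds.2 fun ε hε => ?_⟩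
    obtain ⟨N, hN⟩ := exists_nat_one_div_lt hε
    have h : ∀ᶠ k in atTop, ∀ n ∈ Set.Iic N, m n (w k) = m n y :=
      (eventually_all_finite (Set.finite_Iic N)).2 fun n _ => hy n
    filter_upwards [h] with k hk
    rw [Real.dist_eq, sub_zero,
      abs_of_nonneg (le_max_of_le_left ((rankQuasiMetric m hinj).nonneg _ _))]
    exact max_lt (((rankDist_lt_iff m).2 fun n hn => (hk n hn).le).trans hN)
      (((rankDist_lt_iff m).2 fun n hn => (hk n hn).ge).trans hN)
  · refine TopologicalSpace.ext_iff.2 fun s => ⟨fun hs x hx => ?_, fun hs => ?_⟩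
    · obtain ⟨n, hn⟩ := hbasis s hs x hx
      exact ⟨1 / ((n : ℝ) + 1), by positivity, fun y hy =>
        hn y ((rankDist_lt_iff m).1 hy n le_rfl)⟩
    · refine isOpen_iff_mem_nhds.2 fun x hx => ?_
      obtain ⟨ε, hε, hεs⟩ := hs x hx
      obtain ⟨N, hN⟩ := exists_nat_one_div_lt hε
      have h : ∀ᶠ y in 𝓝 x, ∀ n ∈ Set.Iic N, m n y ≤ m n x :=
        (eventually_all_finite (Set.finite_Iic N)).2 fun n _ =>
          (hopen n x).eventually_mem (show m n x ≤ m n x from le_rfl)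
      filter_upwards [h] with y hy
      exact hεs (((rankDist_lt_iff m).2 hy).trans hN)

end Rank

/-! ### The lattice of open sets of a locally compact countably based space is quasi-Polish -/

open Classical in
/-- The least natural number satisfying `p`, or `⊤` if there is none. -/
noncomputable def firstIndex (p : ℕ → Prop) : ℕ∞ := if h : ∃ k, p k then Nat.find h else ⊤

theorem firstIndex_le_iff {p : ℕ → Prop} {j : ℕ} : firstIndex p ≤ j ↔ ∃ k ≤ j, p k := by
  classical
  unfold firstIndex
  split_ifs with h
  · rw [Nat.cast_le, Nat.find_le_iff]
  · simp only [top_le_iff, ENat.natCast_ne_top, false_iff]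
    exact fun ⟨k, _, hk⟩ => h ⟨k, hk⟩

theorem of_firstIndex_eq {p : ℕ → Prop} {j : ℕ} (h : firstIndex p = j) : p j := by
  classical
  unfold firstIndex at h
  split_ifs at h with hp
  · exact Nat.cast_injective h ▸ Nat.find_spec hp
  · exact absurd h.symm (ENat.natCast_ne_top j)

theorem firstIndex_ne_top_iff {p : ℕ → Prop} : firstIndex p ≠ ⊤ ↔ ∃ k, p k := by
  classical
  unfold firstIndex
  split_ifs with h <;> simp [h]

section

variable {X : Type u} [TopologicalSpace X]

/-- The `i`-th rank of an open set `U`: the least `j` such that `B i` is compactly below `B j` and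
`B j` compactly below `U`. -/
noncomputable def interpolationRank (B : ℕ → Opens X) (i : ℕ) (U : Opens X) : ℕ∞ :=
  firstIndex fun j => CompactlyBelow (B i) (B j) ∧ CompactlyBelow (B j) U

variable {B : ℕ → Opens X}

theorem interpolationRank_ne_top_iff [LocallyCompactSpace X] (hB : IsUnionBasis B) {i : ℕ}
    {U : Opens X} : interpolationRank B i U ≠ ⊤ ↔ CompactlyBelow (B i) U :=
  firstIndex_ne_top_iff.trans
    ⟨fun ⟨_, h1, h2⟩ => h1.mono_right h2.le, fun h => h.exists_between hB⟩

theorem isOpen_setOf_interpolationRank_le (B : ℕ → Opens X) (i : ℕ) (c : ℕ∞) :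
    IsOpen {V : OpenLattice X | interpolationRank B i (ofScott V) ≤ c} := by
  cases c with
  | top => simp
  | coe j =>
    have h : {V : OpenLattice X | interpolationRank B i (ofScott V) ≤ j} =
        ⋃ k ∈ {k | k ≤ j ∧ CompactlyBelow (B i) (B k)},
          {V : OpenLattice X | CompactlyBelow (B k) (ofScott V)} := by
      ext V
      simp [interpolationRank, firstIndex_le_iff, and_assoc]
    rw [h]
    exact isOpen_biUnion fun k _ => CompactlyBelow.isOpen_setOf (B k)

/-- If all ranks stabilize along a sequence of open sets, the union of the basic open sets that are
eventually compactly below its members has the limiting ranks. Since a finite limiting rank of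
`B i` names a fixed `B j` between `B i` and almost all members of the sequence, `B i` is compactly
below this union. -/
theorem exists_interpolationRank_eq [LocallyCompactSpace X] (hB : IsUnionBasis B) {w : ℕ → Opens X}
    (hw : ∀ i, ∃ c, ∀ᶠ k in atTop, interpolationRank B i (w k) = c) :
    ∃ U : Opens X, ∀ i, ∀ᶠ k in atTop, interpolationRank B i (w k) = interpolationRank B i U := by
  choose c hc using hw
  let C : Set ℕ := {i | ∀ᶠ k in atTop, CompactlyBelow (B i) (w k)}
  have hcC : ∀ i (j : ℕ), c i = j → CompactlyBelow (B i) (B j) ∧ j ∈ C := by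
    intro i j hj
    have h : ∀ᶠ k in atTop, CompactlyBelow (B i) (B j) ∧ CompactlyBelow (B j) (w k) :=
      (hc i).mono fun k hk => of_firstIndex_eq (hk.trans hj)
    exact ⟨h.exists.choose_spec.1, h.mono fun k hk => hk.2⟩
  let U : Opens X := ⨆ i : C, B i
  have hCU : ∀ i, i ∈ C ↔ CompactlyBelow (B i) U := by
    intro i
    constructor
    · intro hi
      obtain ⟨k, hk, hik⟩ := ((hc i).and hi).exists
      have hne : c i ≠ ⊤ := hk ▸ (interpolationRank_ne_top_iff hB).2 hik
      lift c i to ℕ using hne with j hj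
      obtain ⟨hij, hjC⟩ := hcC i j hj.symm
      exact hij.mono_right (le_iSup (fun i : C => B i) ⟨j, hjC⟩)
    · intro hi
      have : Nonempty C := by
        obtain ⟨n, hn⟩ := hB.exists_bot
        exact ⟨⟨n, Eventually.of_forall fun k => hn ▸ CompactlyBelow.bot (w k)⟩⟩
      have hdir : Directed (· ≤ ·) fun i : C => B i := fun a b => by
        obtain ⟨k, hk⟩ := hB.exists_sup a b
        refine ⟨⟨k, ?_⟩, le_sup_left.trans hk.ge, le_sup_right.trans hk.ge⟩
        filter_upwards [a.2, b.2] with n han hbn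
        exact hk ▸ han.sup hbn
      obtain ⟨l, hl⟩ := OpenLattice.exists_mem_of_le_iSup (CompactlyBelow.isOpen_setOf (B i))
        hdir (U := U) hi le_rfl
      filter_upwards [l.2] with k hk
      exact CompactlyBelow.mono_right hl hk.le
  refine ⟨U, fun i => ?_⟩
  suffices h : c i = interpolationRank B i U by simpa only [h] using hc i
  refine le_antisymm ?_ ?_
  · cases hj : interpolationRank B i U with
    | top => exact le_top
    | coe j =>
      obtain ⟨hij, hjU⟩ := of_firstIndex_eq hj
      obtain ⟨k, hk, hjk⟩ := ((hc i).and ((hCU j).2 hjU)).exists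
      exact hk ▸ firstIndex_le_iff.2 ⟨j, le_rfl, hij, hjk⟩
  · cases hj : c i with
    | top => exact le_top
    | coe j =>
      obtain ⟨hij, hjC⟩ := hcC i j hj
      exact firstIndex_le_iff.2 ⟨j, le_rfl, hij, (hCU j).1 hjC⟩

theorem OpenLattice.quasiPolish (X : Type u) [TopologicalSpace X] [LocallyCompactSpace X]
    [SecondCountableTopology X] : QuasiPolish (OpenLattice X) := by
  have := OpenLattice.secondCountableTopology (X := X)
  obtain ⟨B, hB⟩ := exists_isUnionBasis X
  refine quasiPolish_of_rank (fun i U => interpolationRank B i (ofScott U)) (fun U V h => ?_)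
    (fun i U => isOpen_setOf_interpolationRank_le B i _) (fun s hs U hU => ?_) (fun w hw => ?_)
  · have hle : ∀ U V : Opens X,
        (∀ i, interpolationRank B i U = interpolationRank B i V) → U ≤ V := by
      intro U V h x hx
      obtain ⟨i, hiU, hxi⟩ := exists_basis_compactlyBelow_mem hB (isOpen_setOf_mem x) (U := U) hx
      rw [← interpolationRank_ne_top_iff hB, h, interpolationRank_ne_top_iff hB] at hiU
      exact hiU.le hxi
    exact le_antisymm (α := Opens X) (hle _ _ h) (hle _ _ fun i => (h i).symm)
  · obtain ⟨i, hiU, hi⟩ := exists_basis_compactlyBelow_mem hB hs (U := ofScott U) hU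
    refine ⟨i, fun V hV => mem_of_le hs (U := B i) (V := ofScott V) ?_ hi⟩
    exact ((interpolationRank_ne_top_iff hB).1 (ne_top_of_le_ne_top
      ((interpolationRank_ne_top_iff hB).2 hiU) hV)).le
  · obtain ⟨U, hU⟩ := exists_interpolationRank_eq hB (w := fun k => ofScott (w k)) hw
    exact ⟨toScott U, hU⟩

end

/-! ### The equivalent conditions -/

theorem mainTheorem11 (X : Type u) [TopologicalSpace X] (hX : QuasiPolish X) :
    List.TFAE [
      LocallyCompactSpace X,
      QuasiPolish (OpenLattice X),
      SecondCountableTopology (OpenLattice X),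
      LocallyCompactSpace (OpenLattice X),
      LocallyCompactSpace (OpenLattice (OpenLattice X))] := by
  have := hX.1
  tfae_have 1 → 2 := fun _ => OpenLattice.quasiPolish X
  tfae_have 2 → 3 := fun h => h.1
  tfae_have 3 → 1 := fun _ => hX.locallyCompactSpace
  tfae_have 1 → 4 := fun _ => OpenLattice.locallyCompactSpace
  tfae_have 4 → 5 := fun _ => OpenLattice.locallyCompactSpace
  tfae_have 5 → 3 := fun _ => by
    have := hX.secondCountableTopology_double
    have := OpenLattice.secondCountableTopology (X := OpenLattice (OpenLattice X))
    exact (OpenLattice.isEmbedding_nhdsFamily hX).secondCountableTopology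
  tfae_finish
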